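/- Let $f_1,\dots,f_s,h\in\mathbb R[x_1,\dots,x_n]$ and let $e\in(\mathbb R\setminus\{0\})^s$. For $e'\in\mathbb R^s$ put $$S_{e'}=\{x\in\mathbb R^n : |f_i(x)|\le |e'_i|\text{ for }1\le i\le s\}.$$ For $I\subseteq\{1,\dots,s\}$ and $\sigma:I\to\{\pm1\}$ let $$A_{I,\sigma,e'}=\{x\in\mathbb R^n : f_i(x)=\sigma_ie'_i\text{ for } i\in I,\ |f_i(x)|<|e'_i|\text{ for } i\notin I\},$$ let $A^{\mathrm{reg}}_{I,\sigma,e'}$ be the set of $x\in A_{I,\sigma,e'}$ at which the differentials $\mathrm d_xf_i$, $i\in I$, are linearly independent, and let $\operatorname{crit}(h,A^{\mathrm{reg}}_{I,\sigma,e'})$ be the set of $x\in A^{\mathrm{reg}}_{I,\sigma,e'}$ at which $\mathrm d_xh$ vanishes on the tangent space $\bigcap_{i\in I}\ker \mathrm d_xf_i$. Put $$\Sigma_{e'}=\bigcup_{I,\sigma}h\big(\operatorname{crit}(h,A^{\mathrm{reg}}_{I,\sigma,e'})\big),\qquad \lim_{r\to0}\Sigma_{re}=\bigcap_{R>0}\overline{\bigcup_{0<r<R}\Sigma_{re}},$$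 where the bar denotes the Euclidean closure. The algorithm LimitCriticalValues, on input $f_1,\dots,f_s,h,e$, starts with $Z=\varnothing$ and does the following for each pair $(I,\sigma)$ with $I\subseteq\{1,\dots,s\}$, $\#I\le n$ and $\sigma:I\to\{\pm1\}$. It forms the ideal $$J'=\Big\langle \sum_{i\in I}\lambda_i\,\partial_jf_i-\partial_jh\Big\rangle_{1\le j\le n}+\big\langle \sigma_je_jf_i-\sigma_ie_if_j\big\rangle_{i,j\in I}$$ of $\mathbb R[x_1,\dots,x_n,(\lambda_i)_{i\in I}]$, where the $\lambda_i$ are new variables; it forms the ideal $J=J'\cap\mathbb R[x_1,\dots,x_n]+\langle f_1,\dots,f_s\rangle$ of $\mathbb R[x_1,\dots,x_n]$; it takes a generator $p$ of the ideal $(J+\langle h-t\rangle)\cap\mathbb R[t]$, where $t$ is a new variable; and it replaces $Z$ by $Z\cup\{t\in\mathbb R : p(t)=0\}$. At the end it returns $Z$. Assume that the restriction of $h$ to $S_e$ is proper. Then the algorithm returns a set $Z\subset\mathbb R$, and, whatever generators $p$ are chosen, the returned set $Z$ is finite and contains $\lim_{r\to0}\Sigma_{re}$. -/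

import Mathlib

open MvPolynomial

namespace LimitCrit

variable {n s : ℕ}

/-! ### Geometry: the sets `S_e`, their strata and the critical values of `h` -/

/-- The polynomial map `F = (f₁, …, f_s) : ℝⁿ → ℝˢ`. -/
noncomputable def polyMap (f : Fin s → MvPolynomial (Fin n) ℝ) (x : Fin n → ℝ) : Fin s → ℝ :=
  fun i => eval x (f i)

/-- `S_e = {x ∈ ℝⁿ | |f_i(x)| ≤ |e_i| for all i}`. -/
def setS (f : Fin s → MvPolynomial (Fin n) ℝ) (e : Fin s → ℝ) : Set (Fin n → ℝ) :=
  {x | ∀ i, |polyMap f x i| ≤ |e i|}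

/-- The pairs `(I, σ)` with `I ⊆ {1, …, s}` and `σ : I → {±1}`. -/
abbrev FaceIndex (s : ℕ) : Type := Σ I : Finset (Fin s), (I → ℤˣ)

/-- The sign `σ_i ∈ {±1}` as a real number. -/
def FaceIndex.sign (k : FaceIndex s) (i : k.1) : ℝ := ((k.2 i : ℤ) : ℝ)

/-- The relatively open face of the hypercube `∏ [-|e_i|, |e_i|]` given by `(I, σ)`: the factor of
index `i` is the point `σ_i e_i` if `i ∈ I`, and the open interval between `-e_i` and `e_i` if
`i ∉ I`. -/
def cubeFace (e : Fin s → ℝ) (k : FaceIndex s) : Set (Fin s → ℝ) :=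
  {y | (∀ i : k.1, y i = k.sign i * e i) ∧ ∀ i, i ∉ k.1 → |y i| < |e i|}

/-- The stratum of `S_e` given by `(I, σ)`, the preimage under `F` of a face of the hypercube. -/
def stratum (f : Fin s → MvPolynomial (Fin n) ℝ) (e : Fin s → ℝ) (k : FaceIndex s) :
    Set (Fin n → ℝ) :=
  polyMap f ⁻¹' cubeFace e k

/-- The differential `d_x g : ℝⁿ → ℝ` of a polynomial function `g`. -/
noncomputable def differential (g : MvPolynomial (Fin n) ℝ) (x : Fin n → ℝ) :
    (Fin n → ℝ) →ₗ[ℝ] ℝ :=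
  ∑ j, eval x (pderiv j g) • LinearMap.proj j

/-- The regular locus of the stratum given by `(I, σ)`: the points where the differentials of the
defining equations, i.e. of the `f_i` with `i ∈ I`, are linearly independent. -/
def regStratum (f : Fin s → MvPolynomial (Fin n) ℝ) (e : Fin s → ℝ) (k : FaceIndex s) :
    Set (Fin n → ℝ) :=
  {x ∈ stratum f e k | LinearIndependent ℝ (fun i : k.1 => differential (f i) x)}

/-- The tangent space at a regular point `x` of a stratum whose equations are
`f_i = const`, `i ∈ I`. -/
noncomputable def tangentSpaceAt (f : Fin s → MvPolynomial (Fin n) ℝ) (k : FaceIndex s)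
    (x : Fin n → ℝ) : Submodule ℝ (Fin n → ℝ) :=
  ⨅ i : k.1, LinearMap.ker (differential (f i) x)

/-- The critical points of the restriction of `h` to the regular locus of a stratum: the points
where `d_x h` vanishes on the tangent space. -/
def critSet (f : Fin s → MvPolynomial (Fin n) ℝ) (h : MvPolynomial (Fin n) ℝ) (e : Fin s → ℝ)
    (k : FaceIndex s) : Set (Fin n → ℝ) :=
  {x ∈ regStratum f e k | ∀ v ∈ tangentSpaceAt f k x, differential h x v = 0}

/-- `Σ_e`, the critical values of `h` on the regular loci of the strata of `S_e`. -/
def critValues (f : Fin s → MvPolynomial (Fin n) ℝ) (h : MvPolynomial (Fin n) ℝ)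
    (e : Fin s → ℝ) : Set ℝ :=
  ⋃ k : FaceIndex s, (fun x => eval x h) '' critSet f h e k

/-- `lim_{r → 0} A_r = ⋂_{R > 0} closure (⋃_{0 < r < R} A_r)`. -/
def limitSet (A : ℝ → Set ℝ) : Set ℝ :=
  ⋂ R ∈ Set.Ioi (0 : ℝ), closure (⋃ r ∈ Set.Ioo (0 : ℝ) R, A r)

/-! ### The algorithm -/

/-- The embedding `ℝ[x] → ℝ[x, λ]`, where there is one new variable `λ_i` for each `i ∈ I`. -/
noncomputable def incl (k : FaceIndex s) :
    MvPolynomial (Fin n) ℝ →ₐ[ℝ] MvPolynomial (Fin n ⊕ k.1) ℝ :=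
  rename Sum.inl

/-- The ideal `J'` of `ℝ[x, λ]` generated by the polynomials
`∑_{i ∈ I} λ_i ∂_j f_i - ∂_j h`, for `j = 1, …, n`, and
`σ_j e_j f_i - σ_i e_i f_j`, for `i, j ∈ I`. -/
noncomputable def lagrangeIdeal (f : Fin s → MvPolynomial (Fin n) ℝ) (h : MvPolynomial (Fin n) ℝ)
    (e : Fin s → ℝ) (k : FaceIndex s) : Ideal (MvPolynomial (Fin n ⊕ k.1) ℝ) :=
  Ideal.span (Set.range fun j : Fin n =>
      ∑ i : k.1, X (Sum.inr i) * incl k (pderiv j (f i)) - incl k (pderiv j h)) +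
    Ideal.span (Set.range fun ij : k.1 × k.1 =>
      incl k (C (k.sign ij.2 * e ij.2) * f ij.1 - C (k.sign ij.1 * e ij.1) * f ij.2))

/-- The ideal `J = J' ∩ ℝ[x] + ⟨f₁, …, f_s⟩` of `ℝ[x]`. -/
noncomputable def limitIdeal (f : Fin s → MvPolynomial (Fin n) ℝ) (h : MvPolynomial (Fin n) ℝ)
    (e : Fin s → ℝ) (k : FaceIndex s) : Ideal (MvPolynomial (Fin n) ℝ) :=
  (lagrangeIdeal f h e k).comap (incl k) + Ideal.span (Set.range f)

/-- The elimination ideal `(J + ⟨h - t⟩) ∩ ℝ[t]`, for an ideal `J` of `ℝ[x]`; here `ℝ[x, t]` is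
the ring of polynomials in `t` with coefficients in `ℝ[x]`. -/
noncomputable def valueIdeal (h : MvPolynomial (Fin n) ℝ) (J : Ideal (MvPolynomial (Fin n) ℝ)) :
    Ideal (Polynomial ℝ) :=
  (J.map Polynomial.C + Ideal.span {Polynomial.C h - Polynomial.X}).comap
    (Polynomial.mapRingHom (C : ℝ →+* MvPolynomial (Fin n) ℝ))

/-- `LoopRun f h e L Z Z'`: executing the body of the loop successively for the pairs `(I, σ)` of
the list `L`, starting with the value `Z` of the variable, can end with the value `Z'`. In each
pass, `p` may be any generator of the ideal `(J + ⟨h - t⟩) ∩ ℝ[t]`, and the set `p⁻¹(0)` of the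
real zeros of `p` is added to `Z`. -/
inductive LoopRun (f : Fin s → MvPolynomial (Fin n) ℝ) (h : MvPolynomial (Fin n) ℝ)
    (e : Fin s → ℝ) : List (FaceIndex s) → Set ℝ → Set ℝ → Prop
  | done (Z : Set ℝ) : LoopRun f h e [] Z Z
  | step (k : FaceIndex s) (L : List (FaceIndex s)) (Z Z' : Set ℝ) (p : Polynomial ℝ)
      (hp : Ideal.span {p} = valueIdeal h (limitIdeal f h e k))
      (hrest : LoopRun f h e L (Z ∪ {t | p.eval t = 0}) Z') : LoopRun f h e (k :: L) Z Z'

/-- `Z` is a possible result of the algorithm `LimitCriticalValues` on input `f₁, …, f_s, h, e`: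
starting from `Z = ∅`, the loop runs through all the pairs `(I, σ)` with `#I ≤ n`, once each and
in any order. -/
def LimitCriticalValuesReturns (f : Fin s → MvPolynomial (Fin n) ℝ) (h : MvPolynomial (Fin n) ℝ)
    (e : Fin s → ℝ) (Z : Set ℝ) : Prop :=
  ∃ L : List (FaceIndex s), L.Nodup ∧ (∀ k : FaceIndex s, k ∈ L ↔ k.1.card ≤ n) ∧
    LoopRun f h e L ∅ Z

end LimitCrit

namespace LimitCrit

/-! Containment: near a limit value `t` there are critical points `x m` for parameters `r m • e`
with `r m → 0`, all in `S_e`. Properness gives a limit point `x₀` with `h(x₀) = t`, and one face `K`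
can be fixed since there are finitely many. With multipliers adjoined, each `x m` is a zero of `J'`.
The multipliers may diverge, but elements of `J' ∩ ℝ[x]` do not involve them and so vanish at `x₀`,
as do the `f_i`. Hence `x₀` is a zero of `J`, and `p(t) = 0` (`exists_face_of_mem_limitSet`).

Finiteness: modulo `J'` every `f_i`, `i ∈ I`, is a constant multiple `u_i r` of one element `r`, and
the Lagrange equations give `dh = ∑ λ_i df_i = (∑ u_i λ_i) dr`. In characteristic zero this forces a
relation `Q(r, h) = 0` which can be chosen with `Q(0, ·) ≠ 0`
(`exists_polynomial_relation_of_finiteType`). As `r ∈ J`, the nonzero polynomial `Q(0, t)` lies in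
the elimination ideal (`valueIdeal_limitIdeal_ne_bot`). -/

open scoped TensorProduct KaehlerDifferential

/-! ### Proportional differentials and algebraic dependence. -/

/-- In characteristic zero, an element with vanishing differential is algebraic. -/
theorem isAlgebraic_of_D_eq_zero {F K : Type*} [Field F] [Field K] [CharZero F] [Algebra F K]
    [Algebra.EssFiniteType F K] (a : K) (ha : KaehlerDifferential.D F K a = 0) :
    IsAlgebraic F a := by
  by_contra htr
  have hinj : Function.Injective (Polynomial.aeval (R := F) a) :=
    transcendental_iff_injective.mp htr
  let : Algebra (Polynomial F) K := (Polynomial.aeval (R := F) a).toAlgebra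
  have hmap (p : Polynomial F) : algebraMap (Polynomial F) K p = Polynomial.aeval a p := rfl
  have : IsScalarTower F (Polynomial F) K := .of_algebraMap_eq' (by
    ext x; simp [hmap])
  have : FaithfulSMul (Polynomial F) K := (faithfulSMul_iff_algebraMap_injective _ _).mpr hinj
  let : Algebra (FractionRing (Polynomial F)) K := FractionRing.liftAlgebra (Polynomial F) K
  have : IsScalarTower (Polynomial F) (FractionRing (Polynomial F)) K :=
    FractionRing.isScalarTower_liftAlgebra _ _
  have : IsScalarTower F (FractionRing (Polynomial F)) K := .of_algebraMap_eq (fun x => by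
    rw [IsScalarTower.algebraMap_apply F (Polynomial F) K,
      IsScalarTower.algebraMap_apply F (Polynomial F) (FractionRing (Polynomial F)),
      ← IsScalarTower.algebraMap_apply (Polynomial F) (FractionRing (Polynomial F)) K])
  have : Algebra.EssFiniteType (FractionRing (Polynomial F)) K := .of_comp F _ K
  have : CharZero (FractionRing (Polynomial F)) :=
    charZero_of_injective_algebraMap (FaithfulSMul.algebraMap_injective F _)
  have : Algebra.FormallySmooth (FractionRing (Polynomial F)) K := .of_perfectField
  have : Algebra.FormallySmooth (Polynomial F) (FractionRing (Polynomial F)) :=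
    .of_isLocalization (nonZeroDivisors _)
  have : Algebra.FormallySmooth (Polynomial F) K := .comp _ (FractionRing (Polynomial F)) _
  -- Formal smoothness of `K` over `F[X]` kills `H1Cotangent`, so `K ⊗ Ω[F[X]/F] → Ω[K/F]` is
  -- injective; it sends `1 ⊗ dX` to `da = 0`.
  have h0 : (1 : K) ⊗ₜ[Polynomial F] KaehlerDifferential.D F (Polynomial F) Polynomial.X = 0 := by
    obtain ⟨y, hy⟩ := (Algebra.H1Cotangent.exact_δ_mapBaseChange F (Polynomial F) K
      ((1 : K) ⊗ₜ KaehlerDifferential.D F (Polynomial F) Polynomial.X)).mp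
      (by rw [KaehlerDifferential.mapBaseChange_tmul, KaehlerDifferential.map_D, hmap]; simp [ha])
    rw [← hy, Subsingleton.elim y 0, map_zero]
  -- The derivation `d/dX` sends `1 ⊗ dX` to `1`, a contradiction.
  have h1 := congrArg
    (((Polynomial.mkDerivation F (1 : K)).liftKaehlerDifferential).liftBaseChange K) h0
  simp at h1

/-- A nonzero polynomial relation between `r` and `h` can be divided by a power of the first
variable until it stays nonzero when `r` is specialized to zero. -/
theorem exists_relation_map_eval_zero_ne_zero {k K : Type*} [Field k] [Field K] [Algebra k K]
    (r h : K) (halg : IsAlgebraic (Algebra.adjoin k {r}) h) :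
    ∃ Q : Polynomial (Polynomial k), Q.map (Polynomial.evalRingHom 0) ≠ 0 ∧
      Q.eval₂ (Polynomial.aeval r : Polynomial k →ₐ[k] K).toRingHom h = 0 := by
  obtain ⟨q, hq0, hq⟩ := halg
  let r' : Algebra.adjoin k {r} := ⟨r, Algebra.self_mem_adjoin_singleton k r⟩
  let φ : Polynomial k →ₐ[k] Algebra.adjoin k {r} := Polynomial.aeval r'
  have hφ (p : Polynomial k) : (φ p : K) = Polynomial.aeval r p :=
    (Polynomial.aeval_algHom_apply (Algebra.adjoin k {r}).val r' p).symm
  have hsurj : Function.Surjective φ.toRingHom := fun y => by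
    obtain ⟨p, hp⟩ := (Algebra.adjoin_singleton_eq_range_aeval k r ▸ y.2 :
      (y : K) ∈ (Polynomial.aeval (R := k) r).range)
    exact ⟨p, Subtype.ext ((hφ p).trans hp)⟩
  obtain ⟨Q, rfl⟩ := Polynomial.map_surjective _ hsurj q
  have hcomp : (algebraMap (Algebra.adjoin k {r}) K).comp φ.toRingHom =
      (Polynomial.aeval r : Polynomial k →ₐ[k] K).toRingHom := RingHom.ext hφ
  have hQ : Q.eval₂ (Polynomial.aeval r : Polynomial k →ₐ[k] K).toRingHom h = 0 := by
    rw [← hcomp, ← Polynomial.eval₂_map]; exact hq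
  by_cases hr : r = 0
  -- For `r = 0` the map `φ` is evaluation at `0` followed by the structure map, so `q ≠ 0` already
  -- gives `Q(0, ·) ≠ 0`.
  · refine ⟨Q, fun h0 => hq0 ?_, hQ⟩
    have : φ.toRingHom = (algebraMap k (Algebra.adjoin k {r})).comp (Polynomial.evalRingHom 0) := by
      refine Polynomial.ringHom_ext (fun a => ?_) ?_
      · exact (φ.commutes a).trans (by simp)
      · apply Subtype.ext
        simp [φ, r', hr]
    rw [this, ← Polynomial.map_map, h0, Polynomial.map_zero]
  · have hQ0 : Q ≠ 0 := fun h0 => hq0 (by rw [h0, Polynomial.map_zero])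
    have hX : ¬ IsUnit (Polynomial.C (Polynomial.X : Polynomial k)) := by
      rw [Polynomial.isUnit_C]; exact Polynomial.not_isUnit_X
    obtain ⟨Q', hQ', hndvd⟩ :=
      (FiniteMultiplicity.of_not_isUnit hX hQ0).exists_eq_pow_mul_and_not_dvd
    refine ⟨Q', fun h0 => hndvd ((Polynomial.C_dvd_iff_dvd_coeff _ _).mpr fun i => ?_), ?_⟩
    · rw [Polynomial.X_dvd_iff, Polynomial.coeff_zero_eq_eval_zero]
      simpa using congrArg (Polynomial.coeff · i) h0
    · rw [hQ'] at hQ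
      simpa [Polynomial.eval₂_mul, Polynomial.eval₂_pow, hr] using hQ

open scoped IntermediateField.algebraAdjoinAdjoin in
/-- In characteristic zero, if `dh` is a multiple of `dr`, then `h` satisfies a polynomial relation
over `k[r]` that stays nontrivial for `r = 0`. -/
theorem exists_polynomial_relation {k K : Type*} [Field k] [CharZero k] [Field K] [Algebra k K]
    [Algebra.EssFiniteType k K] (r h c : K)
    (hd : KaehlerDifferential.D k K h = c • KaehlerDifferential.D k K r) :
    ∃ Q : Polynomial (Polynomial k), Q.map (Polynomial.evalRingHom 0) ≠ 0 ∧
      Q.eval₂ (Polynomial.aeval r : Polynomial k →ₐ[k] K).toRingHom h = 0 := by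
  -- Over the base field `k(r)` one has `dr = 0`, hence `dh = 0`.
  have : Algebra.EssFiniteType (IntermediateField.adjoin k {r}) K := .of_comp k _ K
  have hF : KaehlerDifferential.D (IntermediateField.adjoin k {r}) K h = 0 := by
    have h1 := congrArg (KaehlerDifferential.map k (IntermediateField.adjoin k {r}) K K) hd
    have h2 : KaehlerDifferential.D (IntermediateField.adjoin k {r}) K r = 0 :=
      (KaehlerDifferential.D (IntermediateField.adjoin k {r}) K).map_algebraMap
        ⟨r, IntermediateField.mem_adjoin_simple_self k r⟩
    rw [KaehlerDifferential.map_D, map_smul, KaehlerDifferential.map_D] at h1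
    simpa [h2] using h1
  exact exists_relation_map_eval_zero_ne_zero r h
    ((IsFractionRing.isAlgebraic_iff (Algebra.adjoin k {r})
      (IntermediateField.adjoin k {r}) K).mpr (isAlgebraic_of_D_eq_zero h hF))

/-- In a finitely generated algebra over a field of characteristic zero, if `dh` is a multiple of `dr`, then
`h` satisfies a polynomial relation over `k[r]` that stays nontrivial for `r = 0`. -/
theorem exists_polynomial_relation_of_finiteType {k A : Type*} [Field k] [CharZero k] [CommRing A]
    [Algebra k A] [Algebra.FiniteType k A] (r h c : A)
    (hd : KaehlerDifferential.D k A h = c • KaehlerDifferential.D k A r) :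
    ∃ Q : Polynomial (Polynomial k), Q.map (Polynomial.evalRingHom 0) ≠ 0 ∧
      Q.eval₂ (Polynomial.aeval r : Polynomial k →ₐ[k] A).toRingHom h = 0 := by
  classical
  have : IsNoetherianRing A := Algebra.FiniteType.isNoetherianRing k A
  have key (P : Ideal A) [P.IsPrime] :
      ∃ Q : Polynomial (Polynomial k), Q.map (Polynomial.evalRingHom 0) ≠ 0 ∧
        Q.eval₂ (Polynomial.aeval r : Polynomial k →ₐ[k] A).toRingHom h ∈ P := by
    let K := P.ResidueField
    have : Algebra.EssFiniteType A K := inferInstance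
    have : Algebra.EssFiniteType k K := .comp k A K
    obtain ⟨Q, hQ, hQ0⟩ := exists_polynomial_relation (k := k) (algebraMap A K r)
      (algebraMap A K h) (algebraMap A K c) (by
        have h1 := congrArg (KaehlerDifferential.map k k A K) hd
        rw [KaehlerDifferential.map_D, map_smul, KaehlerDifferential.map_D] at h1
        rw [h1, algebraMap_smul])
    refine ⟨Q, hQ, ?_⟩
    rw [← Ideal.algebraMap_residueField_eq_zero, Polynomial.hom_eval₂]
    convert hQ0 using 2
    refine Polynomial.ringHom_ext (fun a => ?_) ?_
    · simpa using (IsScalarTower.algebraMap_apply k A K a).symm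
    · simp [K]
  choose! Q hQ hQP using key
  have hfin := Ideal.finite_minimalPrimes_of_isNoetherianRing A ⊥
  -- The product over the minimal primes gives a nilpotent value, which a power kills; specializing
  -- `r` to `0` is multiplicative into a domain, so nothing becomes zero.
  let Q₀ := ∏ P ∈ hfin.toFinset, Q P
  have hmem : Q₀.eval₂ (Polynomial.aeval r : Polynomial k →ₐ[k] A).toRingHom h ∈
      (⊥ : Ideal A).radical := by
    rw [← Ideal.sInf_minimalPrimes, Ideal.mem_sInf]
    intro P hP
    rw [Polynomial.eval₂_finsetProd]
    have : P.IsPrime := hP.1.1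
    exact P.mem_of_dvd (Finset.dvd_prod_of_mem _ (hfin.mem_toFinset.mpr hP)) (hQP P)
  obtain ⟨m, hm⟩ := hmem
  refine ⟨Q₀ ^ m, ?_, by rw [Polynomial.eval₂_pow]; exact hm⟩
  rw [Polynomial.map_pow, Polynomial.map_prod]
  refine pow_ne_zero _ (Finset.prod_ne_zero_iff.mpr fun P hP => ?_)
  have : P.IsPrime := (hfin.mem_toFinset.mp hP).1.1
  exact hQ P

/-- The chain rule for a derivation and a polynomial. -/
theorem derivation_aeval {k A M σ : Type*} [CommRing k] [CommRing A] [Algebra k A]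
    [AddCommGroup M] [Module k M] [Module A M] [Fintype σ] (D : Derivation k A M) (x : σ → A)
    (p : MvPolynomial σ k) :
    D (aeval x p) = ∑ j, aeval x (pderiv j p) • D (x j) := by
  classical
  induction p using MvPolynomial.induction_on with
  | C a => simp
  | add p q hp hq => simp [hp, hq, add_smul, Finset.sum_add_distrib]
  | mul_X p i hp =>
    simp [hp, add_smul, Finset.sum_add_distrib, Finset.smul_sum, pderiv_X, Pi.single_apply,
      smul_smul, mul_comm, ite_smul, apply_ite, add_comm]

/-! ### Limits of critical points. -/

variable {n s : ℕ}
open Filter Topology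

variable {f : Fin s → MvPolynomial (Fin n) ℝ} {h : MvPolynomial (Fin n) ℝ} {e : Fin s → ℝ}
  {k : FaceIndex s}

theorem differential_apply_single (g : MvPolynomial (Fin n) ℝ) (x : Fin n → ℝ) (j : Fin n) :
    differential g x (Pi.single j 1) = eval x (pderiv j g) := by
  classical
  simp [differential, Pi.single_apply]

theorem exists_lagrange_multipliers {x : Fin n → ℝ}
    (hx : ∀ v ∈ tangentSpaceAt f k x, differential h x v = 0) :
    ∃ c : k.1 → ℝ, ∀ j, ∑ i, c i * eval x (pderiv j (f i)) = eval x (pderiv j h) := by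
  have hspan := mem_span_of_iInf_ker_le_ker (L := fun i : k.1 => differential (f i) x)
    (K := differential h x) (fun v hv => hx v hv)
  obtain ⟨c, hc⟩ := (Submodule.mem_span_range_iff_exists_fun ℝ).mp hspan
  refine ⟨c, fun j => ?_⟩
  simpa [differential_apply_single] using LinearMap.congr_fun hc (Pi.single j 1)

/-- This is why the algorithm may skip the faces with `#I > n`: their regular loci are empty. -/
theorem card_le_of_mem_regStratum {x : Fin n → ℝ} (hx : x ∈ regStratum f e k) :
    k.1.card ≤ n := by
  simpa using hx.2.fintype_card_le_finrank

/-- The polynomials of `J' ∩ ℝ[x]` vanish at the critical points for all the rescalings of `e`. -/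
theorem eval_eq_zero_of_mem_critSet {r : ℝ} {x : Fin n → ℝ} (hx : x ∈ critSet f h (r • e) k)
    {g : MvPolynomial (Fin n) ℝ} (hg : incl k g ∈ lagrangeIdeal f h e k) : eval x g = 0 := by
  obtain ⟨⟨⟨hface, -⟩, -⟩, hcrit⟩ := hx
  obtain ⟨c, hc⟩ := exists_lagrange_multipliers hcrit
  have hincl (q : MvPolynomial (Fin n) ℝ) : eval (Sum.elim x c) (incl k q) = eval x q := by
    simp [incl, eval_rename]
  -- The point `(x, c)` is a zero of `J'`: the second family of generators is homogeneous in the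
  -- `f_i`, so the common factor `r` in `f_i(x) = σ_i r e_i` does not matter.
  have hle : lagrangeIdeal f h e k ≤ RingHom.ker (eval (Sum.elim x c)) := by
    refine sup_le (Ideal.span_le.mpr ?_) (Ideal.span_le.mpr ?_)
    · rintro _ ⟨j, rfl⟩
      simp only [SetLike.mem_coe, RingHom.mem_ker, map_sub, map_sum, map_mul, eval_X, hincl,
        Sum.elim_inr, hc, sub_self]
    · rintro _ ⟨⟨i, j⟩, rfl⟩
      have hi := hface i
      have hj := hface j
      simp only [polyMap, Pi.smul_apply, smul_eq_mul] at hi hj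
      simp only [SetLike.mem_coe, RingHom.mem_ker, hincl, map_sub, map_mul, eval_C, hi, hj]
      ring
  rw [← hincl]
  exact hle hg

/-- Substituting `x` and `t = h(x)` kills both summands of the ideal being eliminated. -/
theorem eval_eq_zero_of_mem_valueIdeal {J : Ideal (MvPolynomial (Fin n) ℝ)} {x : Fin n → ℝ}
    (hJ : J ≤ RingHom.ker (eval x)) {p : Polynomial ℝ} (hp : p ∈ valueIdeal h J) :
    p.eval (eval x h) = 0 := by
  have hle : J.map Polynomial.C + Ideal.span {Polynomial.C h - Polynomial.X} ≤
      RingHom.ker (Polynomial.eval₂RingHom (eval x) (eval x h)) := by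
    refine sup_le (Ideal.map_le_iff_le_comap.mpr fun g hg => ?_) (Ideal.span_le.mpr ?_)
    · simpa using hJ hg
    · simp [Set.singleton_subset_iff]
  have := hle hp
  rw [RingHom.mem_ker, Polynomial.coe_mapRingHom, Polynomial.coe_eval₂RingHom,
    Polynomial.eval₂_map] at this
  convert this using 1
  rw [Polynomial.eval, show (eval x).comp (C : ℝ →+* MvPolynomial (Fin n) ℝ) = RingHom.id ℝ by
    ext; simp]

theorem setS_smul_subset {r : ℝ} (hr : r ∈ Set.Ioo (0 : ℝ) 1) : setS f (r • e) ⊆ setS f e := by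
  intro x hx i
  refine (hx i).trans ?_
  rw [Pi.smul_apply, smul_eq_mul, abs_mul, abs_of_pos hr.1]
  exact mul_le_of_le_one_left (abs_nonneg _) hr.2.le

theorem stratum_subset_setS : stratum f e k ⊆ setS f e := by
  intro x hx i
  by_cases hi : i ∈ k.1
  · rw [hx.1 ⟨i, hi⟩, abs_mul, FaceIndex.sign]
    rcases Int.units_eq_one_or (k.2 ⟨i, hi⟩) with h1 | h1 <;> simp [h1]
  · exact (hx.2 i hi).le

/-- A limit of critical values is a value of `h` at a point of the zero set of `limitIdeal`. -/
theorem exists_face_of_mem_limitSet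
    (hproper : IsProperMap (fun x : setS f e => eval (x : Fin n → ℝ) h)) {t : ℝ}
    (ht : t ∈ limitSet (fun r : ℝ => critValues f h (r • e))) :
    ∃ k : FaceIndex s, k.1.card ≤ n ∧
      ∀ p ∈ valueIdeal h (limitIdeal f h e k), p.eval t = 0 := by
  have hseq (m : ℕ) : ∃ (r : ℝ) (k : FaceIndex s) (x : Fin n → ℝ),
      r ∈ Set.Ioo (0 : ℝ) (1 / (m + 1)) ∧ x ∈ critSet f h (r • e) k ∧
        dist (eval x h) t < 1 / (m + 1) := by
    have hm : (0 : ℝ) < 1 / (m + 1) := by positivity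
    obtain ⟨u, hu, hut⟩ := Metric.mem_closure_iff.mp (Set.mem_iInter₂.mp ht _ hm) _ hm
    obtain ⟨r, hr, hu⟩ := Set.mem_iUnion₂.mp hu
    obtain ⟨k, x, hx, rfl⟩ := Set.mem_iUnion.mp hu
    exact ⟨r, k, x, hr, hx, by rwa [dist_comm]⟩
  choose r k x hr hx hxt using hseq
  -- Along a free ultrafilter the face is eventually constant and properness yields a limit point,
  -- with no passage to subsequences.
  let U : Ultrafilter ℕ := hyperfilter ℕ
  have hU : (U : Filter ℕ) ≤ atTop := by
    rw [← Nat.cofinite_eq_atTop]; exact hyperfilter_le_cofinite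
  have hlim : Tendsto (fun m : ℕ => (1 : ℝ) / (m + 1)) U (𝓝 0) :=
    tendsto_one_div_add_atTop_nhds_zero_nat.mono_left hU
  have hr0 : Tendsto r U (𝓝 0) :=
    squeeze_zero (fun m => (hr m).1.le) (fun m => (hr m).2.le) hlim
  have hr1 (m : ℕ) : r m ∈ Set.Ioo (0 : ℝ) 1 :=
    ⟨(hr m).1, (hr m).2.trans_le (by rw [div_le_one (by positivity)]; simp)⟩
  obtain ⟨K, hK⟩ : ∃ K, ∀ᶠ m in U, k m = K := by
    have := (U.map k).eq_pure_of_finite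
    obtain ⟨K, hK⟩ := this
    refine ⟨K, ?_⟩
    have : {K} ∈ U.map k := by rw [hK]; exact rfl
    exact this
  have hS (m : ℕ) : x m ∈ setS f (r m • e) := stratum_subset_setS (hx m).1.1
  let y : ℕ → setS f e := fun m => ⟨x m, setS_smul_subset (hr1 m) (hS m)⟩
  obtain ⟨x₀, hx₀, hle⟩ := (isProperMap_iff_ultrafilter.mp hproper).2 (𝒰 := U.map y) (y := t) (by
    rw [Ultrafilter.coe_map, tendsto_map'_iff, tendsto_iff_dist_tendsto_zero]
    exact squeeze_zero (fun _ => dist_nonneg) (fun m => (hxt m).le) hlim)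
  have hxlim : Tendsto x U (𝓝 (x₀ : Fin n → ℝ)) :=
    (continuous_subtype_val.tendsto x₀).comp (show Tendsto y U (𝓝 x₀) from hle)
  have heval (g : MvPolynomial (Fin n) ℝ) :
      Tendsto (fun m => eval (x m) g) U (𝓝 (eval (x₀ : Fin n → ℝ) g)) :=
    ((MvPolynomial.continuous_eval g).tendsto _).comp hxlim
  obtain ⟨m, hm⟩ := hK.exists
  refine ⟨K, hm ▸ card_le_of_mem_regStratum (hx m).1, fun p hp => ?_⟩
  rw [← hx₀]
  refine eval_eq_zero_of_mem_valueIdeal (sup_le (fun g hg => ?_) (Ideal.span_le.mpr ?_)) hp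
  · refine tendsto_nhds_unique (heval g) (tendsto_const_nhds.congr' ?_)
    filter_upwards [hK] with m hm
    exact (eval_eq_zero_of_mem_critSet (hm ▸ hx m) hg).symm
  · rintro _ ⟨i, rfl⟩
    refine tendsto_nhds_unique (heval (f i)) (squeeze_zero_norm (a := fun m => r m * |e i|)
      (fun m => ?_) (by simpa using hr0.mul_const |e i|))
    have := hS m i
    rwa [Pi.smul_apply, smul_eq_mul, abs_mul, abs_of_pos (hr m).1] at this

/-! ### Runs of the loop. -/

theorem exists_loopRun (L : List (FaceIndex s)) (Z : Set ℝ) : ∃ Z', LoopRun f h e L Z Z' := by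
  induction L generalizing Z with
  | nil => exact ⟨Z, .done Z⟩
  | cons k L ih =>
    obtain ⟨p, hp⟩ := (IsPrincipalIdealRing.principal (valueIdeal h (limitIdeal f h e k))).principal
    obtain ⟨Z', hZ'⟩ := ih (Z ∪ {t | p.eval t = 0})
    exact ⟨Z', .step k L Z Z' p hp.symm hZ'⟩

theorem LoopRun.subset {L : List (FaceIndex s)} {Z Z' : Set ℝ} (hrun : LoopRun f h e L Z Z') :
    Z ⊆ Z' := by
  induction hrun with
  | done Z => exact subset_rfl
  | step k L Z Z' p hp hrest ih => exact Set.subset_union_left.trans ih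

theorem LoopRun.mem {L : List (FaceIndex s)} {Z Z' : Set ℝ} (hrun : LoopRun f h e L Z Z')
    (hk : k ∈ L) {t : ℝ} (ht : ∀ p ∈ valueIdeal h (limitIdeal f h e k), p.eval t = 0) :
    t ∈ Z' := by
  induction hrun with
  | done Z => simp at hk
  | step k' L Z Z' p hp hrest ih =>
    rcases List.mem_cons.mp hk with rfl | hk
    · exact hrest.subset (Or.inr (ht p (hp ▸ Ideal.mem_span_singleton_self p)))
    · exact ih hk

theorem LoopRun.finite {L : List (FaceIndex s)} {Z Z' : Set ℝ} (hrun : LoopRun f h e L Z Z')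
    (hne : ∀ k, valueIdeal h (limitIdeal f h e k) ≠ ⊥) (hZ : Z.Finite) : Z'.Finite := by
  induction hrun with
  | done Z => exact hZ
  | step k L Z Z' p hp hrest ih =>
    refine ih (hZ.union ?_)
    have hp0 : p ≠ 0 := by
      rintro rfl
      exact hne k (by simpa using hp.symm)
    exact (p.roots.toFinset.finite_toSet).subset fun t ht => by
      simpa [hp0] using ht

/-! ### Nonvanishing of the elimination ideals. -/

/-- For a derivation of the coordinate ring of `J'`, the derivative of `h` is a multiple of that of
the parameter `r` with `f_i = σ_i e_i r` for `i ∈ I`. -/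
theorem exists_derivation_eq_smul {M : Type*} [AddCommGroup M] [Module ℝ M]
    [Module (MvPolynomial (Fin n ⊕ k.1) ℝ ⧸ lagrangeIdeal f h e k) M]
    [IsScalarTower ℝ (MvPolynomial (Fin n ⊕ k.1) ℝ ⧸ lagrangeIdeal f h e k) M]
    (D : Derivation ℝ (MvPolynomial (Fin n ⊕ k.1) ℝ ⧸ lagrangeIdeal f h e k) M)
    (r : MvPolynomial (Fin n) ℝ) (u : k.1 → ℝ)
    (hr : ∀ i : k.1, incl k (f i - C (u i) * r) ∈ lagrangeIdeal f h e k) :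
    ∃ c : MvPolynomial (Fin n ⊕ k.1) ℝ ⧸ lagrangeIdeal f h e k,
      D (Ideal.Quotient.mkₐ ℝ (lagrangeIdeal f h e k) (incl k h)) =
        c • D (Ideal.Quotient.mkₐ ℝ (lagrangeIdeal f h e k) (incl k r)) := by
  let π := Ideal.Quotient.mkₐ ℝ (lagrangeIdeal f h e k)
  let x : Fin n → MvPolynomial (Fin n ⊕ k.1) ℝ ⧸ lagrangeIdeal f h e k :=
    fun j => π (X (Sum.inl j))
  have hx (g : MvPolynomial (Fin n) ℝ) : π (incl k g) = aeval x g := by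
    have : π.comp (incl k) = aeval x := by
      ext j; simp [incl, x]
    exact DFunLike.congr_fun this g
  let l : k.1 → _ := fun i => π (X (Sum.inr i))
  have hgen (j : Fin n) : aeval x (pderiv j h) = ∑ i, l i * aeval x (pderiv j (f i)) := by
    have hmem : ∑ i : k.1, X (Sum.inr i) * incl k (pderiv j (f i)) - incl k (pderiv j h) ∈
        lagrangeIdeal f h e k := Ideal.mem_sup_left (Ideal.subset_span ⟨j, rfl⟩)
    have h0 : π (∑ i : k.1, X (Sum.inr i) * incl k (pderiv j (f i)) - incl k (pderiv j h)) = 0 :=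
      Ideal.Quotient.eq_zero_iff_mem.mpr hmem
    simp only [map_sub, map_sum, map_mul, hx] at h0
    exact (sub_eq_zero.mp h0).symm
  have hf (i : k.1) : D (aeval x (f i)) = u i • D (aeval x r) := by
    have h0 : π (incl k (f i - C (u i) * r)) = 0 := Ideal.Quotient.eq_zero_iff_mem.mpr (hr i)
    rw [hx, map_sub, map_mul, sub_eq_zero, aeval_C, ← Algebra.smul_def] at h0
    rw [h0, D.map_smul]
  refine ⟨∑ i, u i • l i, ?_⟩
  change D (π _) = _ • D (π _)
  rw [hx, hx, derivation_aeval]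
  simp_rw [hgen, Finset.sum_smul, mul_smul]
  rw [Finset.sum_comm]
  refine (Finset.sum_congr rfl fun i _ => ?_)
  rw [← Finset.smul_sum, ← derivation_aeval D, hf, smul_assoc, ← algebraMap_smul
    (MvPolynomial (Fin n ⊕ k.1) ℝ ⧸ lagrangeIdeal f h e k) (u i),
    ← algebraMap_smul (MvPolynomial (Fin n ⊕ k.1) ℝ ⧸ lagrangeIdeal f h e k) (u i), smul_comm]

/-- The relation `Q(r, h) ∈ J' ∩ ℝ[x]` becomes `Q(0, h) ∈ J` because `r ∈ ⟨f₁, …, f_s⟩`. -/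
theorem valueIdeal_limitIdeal_ne_bot (he : ∀ i, e i ≠ 0) (k : FaceIndex s) :
    valueIdeal h (limitIdeal f h e k) ≠ ⊥ := by
  obtain ⟨r, u, hrf, hr⟩ : ∃ (r : MvPolynomial (Fin n) ℝ) (u : k.1 → ℝ),
      r ∈ Ideal.span (Set.range f) ∧
        ∀ i : k.1, incl k (f i - C (u i) * r) ∈ lagrangeIdeal f h e k := by
    rcases isEmpty_or_nonempty k.1 with hI | ⟨⟨i₀⟩⟩
    -- For `I = ∅` the Lagrange equations say `dh = 0`, so `r = 0` serves.
    · exact ⟨0, 0, zero_mem _, fun i => isEmptyElim i⟩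
    · have hv : k.sign i₀ * e i₀ ≠ 0 := mul_ne_zero (by simp [FaceIndex.sign]) (he _)
      refine ⟨C (k.sign i₀ * e i₀)⁻¹ * f i₀, fun i => k.sign i * e i,
        Ideal.mul_mem_left _ _ (Ideal.subset_span ⟨_, rfl⟩), fun i => ?_⟩
      have hmem : incl k (C (k.sign i₀ * e i₀) * f i - C (k.sign i * e i) * f i₀) ∈
          lagrangeIdeal f h e k := Ideal.mem_sup_right (Ideal.subset_span ⟨(i, i₀), rfl⟩)
      convert Ideal.mul_mem_left _ (incl k (C (k.sign i₀ * e i₀)⁻¹)) hmem using 1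
      rw [← map_mul, mul_sub, ← mul_assoc, ← mul_assoc, ← mul_assoc, ← C_mul, ← C_mul, ← C_mul,
        inv_mul_cancel₀ hv, C_1, one_mul]
      congr 2
      rw [mul_comm (k.sign i₀ * e i₀)⁻¹]
  obtain ⟨c, hc⟩ := exists_derivation_eq_smul (KaehlerDifferential.D ℝ _) r u hr
  obtain ⟨Q, hQ0, hQ⟩ := exists_polynomial_relation_of_finiteType _ _ _ hc
  let Qrh : MvPolynomial (Fin n) ℝ :=
    Q.eval₂ (Polynomial.aeval r : Polynomial ℝ →ₐ[ℝ] MvPolynomial (Fin n) ℝ).toRingHom h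
  have hmemJ : Qrh ∈ limitIdeal f h e k := by
    refine Ideal.mem_sup_left (Ideal.mem_comap.mpr (Ideal.Quotient.eq_zero_iff_mem.mp ?_))
    rw [← hQ, ← Ideal.Quotient.mkₐ_eq_mk ℝ]
    change (((Ideal.Quotient.mkₐ ℝ (lagrangeIdeal f h e k)).comp (incl k)).toRingHom) _ = _
    rw [Polynomial.hom_eval₂]
    congr 1
    refine Polynomial.ringHom_ext (fun a => ?_) ?_
    · exact (congrArg _ (Polynomial.aeval_C r a)).trans
        ((((Ideal.Quotient.mkₐ ℝ (lagrangeIdeal f h e k)).comp (incl k)).commutes a).trans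
          (Polynomial.aeval_C _ a).symm)
    · simp
  let q := Q.map (Polynomial.evalRingHom (0 : ℝ))
  have hr' : r ∈ limitIdeal f h e k := Ideal.mem_sup_right hrf
  have hqh : Polynomial.aeval h q ∈ limitIdeal f h e k := by
    rw [← Ideal.Quotient.eq_zero_iff_mem] at hmemJ hr' ⊢
    rw [← hmemJ, Polynomial.hom_eval₂, Polynomial.aeval_def, Polynomial.eval₂_map,
      Polynomial.hom_eval₂]
    congr 1
    refine Polynomial.ringHom_ext (fun a => ?_) ?_
    · simp
    · simp [hr']
  rw [Submodule.ne_bot_iff]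
  refine ⟨q, ?_, hQ0⟩
  rw [valueIdeal, Ideal.mem_comap, Polynomial.coe_mapRingHom]
  -- Since `h - t` divides `q(h) - q(t)`, membership of `q(h)` in `J` puts `q(t)` in `J + ⟨h - t⟩`.
  have hdvd : Polynomial.C h - Polynomial.X ∣ Polynomial.C (Polynomial.aeval h q) - q.map C := by
    have := Polynomial.sub_dvd_eval_sub (Polynomial.C h) Polynomial.X
      ((q.map C).map (Polynomial.C : MvPolynomial (Fin n) ℝ →+* _))
    convert this using 2
    · rw [Polynomial.map_map, Polynomial.eval_map, Polynomial.aeval_def, Polynomial.hom_eval₂]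
      rfl
    · rw [Polynomial.eval_map, Polynomial.eval₂_C_X]
  have h1 := Ideal.mem_sup_left (T := Ideal.span {Polynomial.C h - Polynomial.X})
    (Ideal.mem_map_of_mem Polynomial.C hqh)
  have h2 := Ideal.mem_sup_right (S := (limitIdeal f h e k).map Polynomial.C)
    (Ideal.mem_span_singleton.mpr hdvd)
  rw [← sub_sub_cancel (Polynomial.C (Polynomial.aeval h q)) (q.map C)]
  exact sub_mem h1 h2

end LimitCrit

theorem mainTheorem9 (n s : ℕ) (f : Fin s → MvPolynomial (Fin n) ℝ) (h : MvPolynomial (Fin n) ℝ)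
    (e : Fin s → ℝ) (he : ∀ i, e i ≠ 0)
    (hproper : IsProperMap (fun x : LimitCrit.setS f e => MvPolynomial.eval (x : Fin n → ℝ) h)) :
    (∃ Z : Set ℝ, LimitCrit.LimitCriticalValuesReturns f h e Z) ∧
    ∀ Z : Set ℝ, LimitCrit.LimitCriticalValuesReturns f h e Z →
      Z.Finite ∧ LimitCrit.limitSet (fun r : ℝ => LimitCrit.critValues f h (r • e)) ⊆ Z := by
  classical
  refine ⟨?_, ?_⟩
  · let L := (Finset.univ.filter fun k : LimitCrit.FaceIndex s => k.1.card ≤ n).toList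
    obtain ⟨Z, hZ⟩ := LimitCrit.exists_loopRun (f := f) (h := h) (e := e) L ∅
    exact ⟨Z, L, Finset.nodup_toList _, fun k => by simp [L], hZ⟩
  · rintro Z ⟨L, -, hL, hrun⟩
    refine ⟨hrun.finite (LimitCrit.valueIdeal_limitIdeal_ne_bot he) Set.finite_empty,
      fun t ht => ?_⟩
    obtain ⟨k, hk, hkt⟩ := LimitCrit.exists_face_of_mem_limitSet hproper ht
    exact hrun.mem ((hL k).mpr hk) hkt
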